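/- Let $S^1=\mathbb R/\mathbb Z$ and let $\mathrm{Diff}^1(S^1)$ be the group of orientation-preserving $C^1$-diffeomorphisms of $S^1$. Let $f\in\mathrm{Diff}^1(S^1)$ have irrational rotation number. A (maximal) wandering interval of such a diffeomorphism is the closure of a connected component of the complement of its unique minimal set. For a diffeomorphism $g$ of $S^1$ and a compact interval $I\subset S^1$, the distortion of $g$ on $I$ is $\Delta(g,I)=\max_{x,y\in I}\log\frac{dg(x)}{dg(y)}$. Then for every $\varepsilon>0$ there is a diffeomorphism $h\in\mathrm{Diff}^1(S^1)$ such that $g=hfh^{-1}$ satisfies $\Delta(g,I)\le\varepsilon$ for every (maximal) wandering interval $I$ of $g$. -/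

import Mathlib

namespace CircleDynamics

/-- The circle `ℝ / ℤ`. -/
abbrev S1 : Type := UnitAddCircle

/-- `F` is a continuous monotone lift to `ℝ`, commuting with the translation by `1`,
of the circle map `f`. Two such lifts of the same map differ by a constant integer. -/
def IsLift (F : CircleDeg1Lift) (f : S1 → S1) : Prop :=
  Continuous F ∧ ∀ t : ℝ, ((F t : ℝ) : S1) = f (t : S1)

/-- A homeomorphism of the circle is an (orientation preserving) `C¹`-diffeomorphism if it has a
`C¹` lift with everywhere positive derivative. -/
def IsC1Diffeo (f : S1 ≃ₜ S1) : Prop :=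
  ∃ F : CircleDeg1Lift, IsLift F f ∧ ContDiff ℝ 1 F ∧ ∀ t : ℝ, 0 < deriv F t

theorem isC1Diffeo_one : IsC1Diffeo 1 :=
  ⟨1, ⟨continuous_id, fun _ => rfl⟩, contDiff_id, fun t => by
    rw [CircleDeg1Lift.coe_one, deriv_id]; exact one_pos⟩

theorem IsC1Diffeo.mul {f g : S1 ≃ₜ S1} (hf : IsC1Diffeo f) (hg : IsC1Diffeo g) :
    IsC1Diffeo (f * g) := by
  obtain ⟨F, ⟨hFc, hFl⟩, hF1, hF2⟩ := hf
  obtain ⟨G, ⟨hGc, hGl⟩, hG1, hG2⟩ := hg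
  refine ⟨F * G, ⟨hFc.comp hGc, fun t => ?_⟩, hF1.comp hG1, fun t => ?_⟩
  · rw [CircleDeg1Lift.mul_apply, hFl, hGl]; rfl
  · rw [CircleDeg1Lift.coe_mul, deriv_comp t (hF1.differentiable one_ne_zero _)
      (hG1.differentiable one_ne_zero _)]
    exact mul_pos (hF2 _) (hG2 _)

theorem IsC1Diffeo.inv {f : S1 ≃ₜ S1} (hf : IsC1Diffeo f) : IsC1Diffeo f⁻¹ := by
  obtain ⟨F, ⟨hFc, hFl⟩, hF1, hF2⟩ := hf
  have hmono : StrictMono F := strictMono_of_deriv_pos hF2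
  have hsurj : Function.Surjective F := F.continuous_iff_surjective.1 hFc
  let e : ℝ ≃o ℝ := hmono.orderIsoOfSurjective F hsurj
  have he : ∀ x, F (e.symm x) = x := fun x => e.apply_symm_apply x
  let G : CircleDeg1Lift := ⟨⟨e.symm, e.symm.monotone⟩, fun x => by
    apply hmono.injective
    change F (e.symm (x + 1)) = F (e.symm x + 1)
    rw [F.map_add_one, he, he]⟩
  have hFG : ∀ x, F (G x) = x := he
  have hder : ∀ x, HasDerivAt F (deriv F x) x := fun x =>
    (hF1.differentiable one_ne_zero x).hasDerivAt
  have hG1 : ContDiff ℝ 1 G :=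
    e.toHomeomorph.contDiff_symm_deriv (f' := deriv F) (fun x => (hF2 x).ne') hder hF1
  refine ⟨G, ⟨hG1.continuous, fun t => ?_⟩, hG1, fun t => ?_⟩
  · apply f.injective
    rw [← hFl, hFG]
    exact (f.apply_symm_apply _).symm
  · have h := (hder (G t)).comp t (hG1.differentiable one_ne_zero t).hasDerivAt
    have h' : (F : ℝ → ℝ) ∘ G = id := funext hFG
    rw [h'] at h
    have h1 : deriv F (G t) * deriv G t = 1 := h.unique (hasDerivAt_id t)
    exact pos_of_mul_pos_right (h1 ▸ one_pos) (hF2 _).le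

/-- The group `Diff¹(S¹)` of orientation preserving `C¹`-diffeomorphisms of the circle; the
product is composition. -/
def Diff1 : Subgroup (S1 ≃ₜ S1) where
  carrier := {f | IsC1Diffeo f}
  mul_mem' := IsC1Diffeo.mul
  one_mem' := isC1Diffeo_one
  inv_mem' := IsC1Diffeo.inv

/-- The circle map `f` has rotation number `ρ ∈ ℝ / ℤ`: the class modulo `1` of the translation
number `lim (Fⁿ(t) - t) / n` of a lift `F` of `f` is `ρ`. -/
def HasRotationNumber (f : S1 → S1) (ρ : S1) : Prop :=
  ∃ F : CircleDeg1Lift, IsLift F f ∧ ((F.translationNumber : ℝ) : S1) = ρ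

/-- `K` is a minimal set of `f`: it is minimal for inclusion among the nonempty closed
invariant subsets of the circle. -/
def IsMinimalSet (f : S1 → S1) (K : Set S1) : Prop :=
  Minimal (fun A : Set S1 => A.Nonempty ∧ IsClosed A ∧ f '' A = A) K

/-- `I` is a (maximal) wandering interval of `f`: the closure of a connected component of the
complement of the minimal set of `f`. -/
def IsWanderingInterval (f : S1 → S1) (I : Set S1) : Prop :=
  ∃ K : Set S1, IsMinimalSet f K ∧ ∃ x ∈ Kᶜ, I = closure (connectedComponentIn Kᶜ x)

/-- The circle map `f` has derivative `d` at `x`, computed in a lift. -/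
def HasCircleDerivAt (f : S1 → S1) (d : ℝ) (x : S1) : Prop :=
  ∃ F : CircleDeg1Lift, IsLift F f ∧ ∃ t : ℝ, (t : S1) = x ∧ HasDerivAt F d t

/-- `δ` is the distortion of `f` on `I`, that is, the maximum over `x, y ∈ I` of
`log (df(x) / df(y))`. -/
def IsDistortion (f : S1 → S1) (I : Set S1) (δ : ℝ) : Prop :=
  IsGreatest {r : ℝ | ∃ x ∈ I, ∃ y ∈ I, ∃ a b : ℝ,
    HasCircleDerivAt f a x ∧ HasCircleDerivAt f b y ∧ r = Real.log (a / b)} δ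

end CircleDynamics

namespace CircleDynamics

open Set Function

/-! Put φ = log DF for a lift F of f. Without periodic points, the iterates of a gap of an invariant
set are pairwise disjoint modulo 1, so a bounded number of them, independent of the gap, have length
at least δ (`card_large_gaps_le`). On the short iterates φ oscillates little by uniform continuity.
Hence, for one n serving all gaps, the Birkhoff average S_n φ / n oscillates by at most ε on each
gap (`exists_birkhoffSum_sub_le`). Conjugating by h replaces φ, read at H t, by φ + log DH ∘ F - log
DH. Since φ is cohomologous to S_n φ / n through a continuous u
(`exists_cohomologous_birkhoffAverage`), and u is log DH up to a constant (`exists_log_deriv_eq`),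
the conjugate has log-derivative S_n φ / n. -/

/-! ### Lifts and rotation numbers -/

theorem coe_eq_coe_iff {x y : ℝ} : (x : S1) = (y : S1) ↔ ∃ m : ℤ, x = y + m := by
  rw [← sub_eq_zero, ← AddCircle.coe_sub, AddCircle.coe_eq_zero_iff]
  constructor
  · rintro ⟨m, hm⟩
    exact ⟨m, by rw [zsmul_one] at hm; linarith⟩
  · rintro ⟨m, hm⟩
    exact ⟨m, by rw [zsmul_one]; linarith⟩

/-- Two lifts of the same circle map differ by a constant integer. -/
theorem IsLift.exists_int {F G : CircleDeg1Lift} {f : S1 → S1} (hF : IsLift F f)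
    (hG : IsLift G f) : ∃ m : ℤ, ∀ t, G t = F t + m := by
  have key : ∀ t, ∃ m : ℤ, G t = F t + m := fun t =>
    coe_eq_coe_iff.1 ((hG.2 t).trans (hF.2 t).symm)
  have hdisc : DiscreteTopology (range ((↑) : ℤ → ℝ)) :=
    Int.isClosedEmbedding_coe_real.isEmbedding.toHomeomorph.symm.isEmbedding.discreteTopology
  obtain ⟨m, hm⟩ := key 0
  refine ⟨m, fun t => ?_⟩
  -- The difference of the lifts is continuous with values in the discrete set of integers.
  have h := isPreconnected_univ.constant_of_mapsTo (T := range ((↑) : ℤ → ℝ))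
    (f := fun t => G t - F t) ⟨hdisc⟩ (hG.1.sub hF.1).continuousOn
    (fun t _ => by
      obtain ⟨k, hk⟩ := key t
      exact ⟨k, by simp [hk]⟩) (mem_univ t) (mem_univ 0)
  simp only [hm] at h
  linarith

theorem IsLift.iterate {F : CircleDeg1Lift} {f : S1 → S1} (hF : IsLift F f) (n : ℕ) (t : ℝ) :
    ((F^[n] t : ℝ) : S1) = f^[n] (t : S1) := by
  induction n generalizing t with
  | zero => rfl
  | succ n ih => rw [iterate_succ_apply, iterate_succ_apply, ih, hF.2]

/-- A circle map with irrational rotation number has no periodic points. -/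
theorem HasRotationNumber.iterate_ne {f : S1 → S1} {α : ℝ} (hα : Irrational α)
    (hf : HasRotationNumber f (α : S1)) {F : CircleDeg1Lift} (hF : IsLift F f) {n : ℕ}
    (hn : 0 < n) (m : ℤ) (t : ℝ) : F^[n] t ≠ t + m := by
  intro h
  obtain ⟨G, hG, hτ⟩ := hf
  have hper : ((G^[n] t : ℝ) : S1) = (t : S1) := by
    rw [hG.iterate, ← hF.iterate, h, coe_eq_coe_iff]
    exact ⟨m, rfl⟩
  obtain ⟨k, hk⟩ := coe_eq_coe_iff.1 hper
  have hτ' := G.translationNumber_of_map_pow_eq_add_int (x := t) (n := n) (m := k)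
    (by rw [CircleDeg1Lift.coe_pow, hk]) hn
  obtain ⟨l, hl⟩ := coe_eq_coe_iff.1 hτ
  -- The periodic point forces translation number k / n, which equals α + l.
  refine hα ⟨(k : ℚ) / n - l, ?_⟩
  push_cast
  linarith

theorem periodic_deriv (F : CircleDeg1Lift) : Periodic (deriv F) 1 := fun t => by
  rw [← deriv_comp_add_const]
  have : (fun x => F (x + 1)) = fun x => F x + 1 := funext F.map_add_one
  rw [this, deriv_add_const]

/-! ### Diffeomorphisms with prescribed log-derivative -/

/-- A degree one lift which is a `C¹`-diffeomorphism induces an element of `Diff¹(S¹)`. -/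
theorem exists_diff1_isLift {H : CircleDeg1Lift} (hH1 : ContDiff ℝ 1 H)
    (hH2 : ∀ t, 0 < deriv H t) : ∃ h : Diff1, IsLift H h.1 := by
  have hmono : StrictMono H := strictMono_of_deriv_pos hH2
  obtain ⟨U, rfl⟩ := CircleDeg1Lift.isUnit_iff_bijective.2
    ⟨hmono.injective, H.continuous_iff_surjective.1 hH1.continuous⟩
  have hcont : ∀ V : CircleDeg1Liftˣ, Continuous (V : CircleDeg1Lift) := fun V =>
    (CircleDeg1Lift.continuous_iff_surjective _).2
      (CircleDeg1Lift.isUnit_iff_bijective.1 V.isUnit).2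
  have hper : ∀ V : CircleDeg1Liftˣ,
      Periodic (fun t => (((V : CircleDeg1Lift) t : ℝ) : S1)) 1 := fun V t => by
    simp only [CircleDeg1Lift.map_add_one]
    exact AddCircle.coe_add_period 1 _
  have hc : ∀ V : CircleDeg1Liftˣ, Continuous (hper V).lift := fun V =>
    continuous_coinduced_dom.2 ((AddCircle.continuous_mk' 1).comp (hcont V))
  let h : S1 ≃ₜ S1 :=
    { toFun := (hper U).lift
      invFun := (hper U⁻¹).lift
      left_inv := fun x => by
        induction x using QuotientAddGroup.induction_on with
        | H t =>
          change (hper U⁻¹).lift (((U : CircleDeg1Lift) t : ℝ) : S1) = _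
          rw [Periodic.lift_coe, CircleDeg1Lift.units_inv_apply_apply]
      right_inv := fun x => by
        induction x using QuotientAddGroup.induction_on with
        | H t =>
          change (hper U).lift ((((U⁻¹ : CircleDeg1Liftˣ) : CircleDeg1Lift) t : ℝ) : S1) = _
          rw [Periodic.lift_coe, CircleDeg1Lift.units_apply_inv_apply]
      continuous_toFun := hc U
      continuous_invFun := hc U⁻¹ }
  have hl : IsLift (U : CircleDeg1Lift) h := ⟨hH1.continuous, fun t => rfl⟩
  exact ⟨⟨h, _, hl, hH1, hH2⟩, hl⟩

/-- A continuous `1`-periodic function is, up to a constant, the logarithm of the derivative of a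
`C¹`-diffeomorphism of the circle. -/
theorem exists_log_deriv_eq {u : ℝ → ℝ} (hu : Continuous u) (hper : Periodic u 1) :
    ∃ (H : CircleDeg1Lift) (c : ℝ), ContDiff ℝ 1 H ∧ (∀ t, 0 < deriv H t) ∧
      ∀ t, Real.log (deriv H t) = u t - c := by
  have hcont : Continuous fun t => Real.exp (u t) := hu.rexp
  have hint : ∀ a b, IntervalIntegrable (fun t => Real.exp (u t)) MeasureTheory.volume a b :=
    fun a b => hcont.intervalIntegrable a b
  have hexp : Periodic (fun t => Real.exp (u t)) 1 := fun t => by simp only [hper t]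
  -- Dividing by C gives the primitive of exp u degree one; this costs the constant log C.
  set C : ℝ := ∫ t in (0 : ℝ)..1, Real.exp (u t) with hC
  have hCpos : 0 < C :=
    intervalIntegral.intervalIntegral_pos_of_pos (hint 0 1) (fun t => Real.exp_pos _) one_pos
  let H₀ : ℝ → ℝ := fun t => C⁻¹ * ∫ s in (0 : ℝ)..t, Real.exp (u s)
  have hd : ∀ t, HasDerivAt H₀ (C⁻¹ * Real.exp (u t)) t := fun t =>
    (intervalIntegral.integral_hasDerivAt_right (hint 0 t)
      hcont.aestronglyMeasurable.stronglyMeasurableAtFilter hcont.continuousAt).const_mul _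
  have hpos : ∀ t, 0 < C⁻¹ * Real.exp (u t) := fun t => mul_pos (inv_pos.2 hCpos) (Real.exp_pos _)
  have hderiv : deriv H₀ = fun t => C⁻¹ * Real.exp (u t) := funext fun t => (hd t).deriv
  have hmono : StrictMono H₀ := strictMono_of_deriv_pos fun t => by rw [hderiv]; exact hpos t
  let H : CircleDeg1Lift := ⟨⟨H₀, hmono.monotone⟩, fun t => by
    change C⁻¹ * _ = C⁻¹ * _ + 1
    rw [← intervalIntegral.integral_add_adjacent_intervals (hint 0 t) (hint t (t + 1)),
      hexp.intervalIntegral_add_eq t 0, zero_add, ← hC, mul_add, inv_mul_cancel₀ hCpos.ne']⟩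
  refine ⟨H, Real.log C, ?_, fun t => ?_, fun t => ?_⟩
  · refine contDiff_one_iff_deriv.2 ⟨fun t => (hd t).differentiableAt, ?_⟩
    change Continuous (deriv H₀)
    rw [hderiv]
    exact continuous_const.mul hcont
  · change 0 < deriv H₀ t
    rw [hderiv]
    exact hpos t
  · change Real.log (deriv H₀ t) = _
    rw [hderiv, Real.log_mul (inv_pos.2 hCpos).ne' (Real.exp_pos _).ne', Real.log_inv,
      Real.log_exp]
    ring

/-! ### Birkhoff sums on gaps -/

/-- There are at most `⌊1 / δ⌋ + 1` pairwise `δ`-separated points in `[0, 1)`. -/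
theorem card_le_of_separated {ι : Type*} {s : Finset ι} {x : ι → ℝ} {δ : ℝ} (hδ : 0 < δ)
    (hx : ∀ i ∈ s, x i ∈ Ico (0 : ℝ) 1)
    (hsep : ∀ i ∈ s, ∀ j ∈ s, i ≠ j → x i ≤ x j → δ ≤ x j - x i) :
    s.card ≤ ⌊1 / δ⌋₊ + 1 := by
  have hsep' : ∀ i ∈ s, ∀ j ∈ s, x i ≤ x j → ⌊x i / δ⌋₊ = ⌊x j / δ⌋₊ → i = j := by
    intro i hi j hj hij hfl
    by_contra hne
    have h1 := hsep i hi j hj hne hij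
    have h2 : x i / δ + 1 ≤ x j / δ := by
      rw [div_add_one hδ.ne']
      exact div_le_div_of_nonneg_right (by linarith) hδ.le
    have h3 := Nat.floor_mono h2
    rw [Nat.floor_add_one (div_nonneg (hx i hi).1 hδ.le)] at h3
    omega
  rw [← Finset.card_range (⌊1 / δ⌋₊ + 1)]
  refine Finset.card_le_card_of_injOn (fun i => ⌊x i / δ⌋₊) (fun i hi => ?_)
    (fun i hi j hj hij => ?_)
  · simp only [Finset.coe_range, mem_Iio, Nat.lt_succ_iff]
    exact Nat.floor_mono (div_le_div_of_nonneg_right (hx i hi).2.le hδ.le)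
  · rcases le_total (x i) (x j) with h | h
    · exact hsep' i hi j hj h hij
    · exact (hsep' j hj i hi h hij.symm).symm

theorem uniformContinuous_of_periodic {φ : ℝ → ℝ} (hφ : Continuous φ) (hper : Periodic φ 1) :
    UniformContinuous φ := by
  have hc : Continuous (hper.lift : S1 → ℝ) := continuous_coinduced_dom.2 hφ
  have hmk : UniformContinuous (QuotientAddGroup.mk' (AddSubgroup.zmultiples (1 : ℝ))) :=
    uniformContinuous_addMonoidHom_of_continuous (AddCircle.continuous_mk' (1 : ℝ))
  exact (CompactSpace.uniformContinuous_of_continuous hc).comp hmk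

theorem exists_abs_le_of_periodic {φ : ℝ → ℝ} (hφ : Continuous φ) (hper : Periodic φ 1) :
    ∃ M : ℝ, ∀ t, |φ t| ≤ M := by
  obtain ⟨M, hM⟩ := (isCompact_Icc (a := (0 : ℝ)) (b := 1)).exists_bound_of_continuousOn
    hφ.continuousOn
  refine ⟨M, fun t => ?_⟩
  obtain ⟨s, hs, hst⟩ := hper.exists_mem_Ico₀ one_pos t
  rw [hst]
  exact hM s (Ico_subset_Icc_self hs)

/-- The orbit of a gap `(a, b)` of an invariant set under a lift without periodic points has few
large members modulo `1`. -/
theorem card_large_gaps_le {F : CircleDeg1Lift} (hmono : StrictMono F)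
    (hirr : ∀ n : ℕ, 0 < n → ∀ (m : ℤ) (t : ℝ), F^[n] t ≠ t + m) {A : Set ℝ}
    (hA : ∀ t ∈ A, ∀ m : ℤ, t + m ∈ A) (hFA : ∀ t, F t ∈ A ↔ t ∈ A) (hFs : Surjective F) {a b : ℝ}
    (ha : a ∈ A) (hgap : ∀ t ∈ Ioo a b, t ∉ A) {δ : ℝ} (hδ : 0 < δ) (n : ℕ) :
    ((Finset.range n).filter fun k => δ ≤ F^[k] b - F^[k] a).card ≤ ⌊1 / δ⌋₊ + 1 := by
  have hiter : ∀ k t, F^[k] t ∈ A ↔ t ∈ A := by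
    intro k
    induction k with
    | zero => exact fun t => Iff.rfl
    | succ k ih => exact fun t => by rw [iterate_succ_apply, ih, hFA]
  have hgap' : ∀ k, ∀ t ∈ Ioo (F^[k] a) (F^[k] b), t ∉ A := by
    intro k t ht htA
    obtain ⟨s, rfl⟩ := hFs.iterate k t
    exact hgap s ⟨(hmono.iterate k).lt_iff_lt.1 ht.1, (hmono.iterate k).lt_iff_lt.1 ht.2⟩
      ((hiter k s).1 htA)
  have hne : ∀ i j : ℕ, i < j → ∀ m : ℤ, F^[j] a ≠ F^[i] a + m := by
    intro i j hij m h
    obtain ⟨d, rfl⟩ := Nat.exists_eq_add_of_lt hij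
    refine hirr (d + 1) d.succ_pos m (F^[i] a) ?_
    rw [← iterate_add_apply, ← h, add_comm, ← add_assoc]
  have hne' : ∀ i j : ℕ, i ≠ j → ∀ m : ℤ, F^[j] a ≠ F^[i] a + m := by
    intro i j hij m h
    rcases lt_or_gt_of_ne hij with hlt | hlt
    · exact hne i j hlt m h
    · refine hne j i hlt (-m) ?_
      rw [h]; push_cast; ring
  -- Left endpoints modulo 1 are separated: the next one to the right lies in `A`, hence outside the
  -- gap of length at least δ.
  refine card_le_of_separated (x := fun k => Int.fract (F^[k] a)) hδ
    (fun i _ => ⟨Int.fract_nonneg _, Int.fract_lt_one _⟩) (fun i hi j _ hij hle => ?_)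
  have hlen := (Finset.mem_filter.1 hi).2
  have hmem := hA _ ((hiter j a).2 ha) (⌊F^[i] a⌋ - ⌊F^[j] a⌋)
  have h1 : F^[i] a < F^[j] a + ((⌊F^[i] a⌋ - ⌊F^[j] a⌋ : ℤ) : ℝ) := by
    refine lt_of_le_of_ne ?_ fun h => hne' j i hij.symm _ h
    push_cast
    simp only [Int.fract] at hle
    linarith
  have h2 : F^[i] b ≤ F^[j] a + ((⌊F^[i] a⌋ - ⌊F^[j] a⌋ : ℤ) : ℝ) := by
    by_contra! hlt
    exact hgap' i _ ⟨h1, hlt⟩ hmem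
  push_cast at h2
  simp only [Int.fract]
  linarith

/-- Birkhoff averages of a continuous periodic function have small oscillation on the gaps of
invariant sets. -/
theorem exists_birkhoffSum_sub_le {F : CircleDeg1Lift} (hmono : StrictMono F)
    (hFs : Surjective F) (hirr : ∀ n : ℕ, 0 < n → ∀ (m : ℤ) (t : ℝ), F^[n] t ≠ t + m)
    {φ : ℝ → ℝ} (hφ : Continuous φ) (hper : Periodic φ 1) {ε : ℝ} (hε : 0 < ε) :
    ∃ n : ℕ, 0 < n ∧ ∀ A : Set ℝ, (∀ t ∈ A, ∀ m : ℤ, t + m ∈ A) → (∀ t, F t ∈ A ↔ t ∈ A) →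
      ∀ a ∈ A, ∀ b, (∀ t ∈ Ioo a b, t ∉ A) → ∀ s ∈ Icc a b, ∀ t ∈ Icc a b,
        birkhoffSum F φ n s - birkhoffSum F φ n t ≤ n * ε := by
  obtain ⟨M, hM⟩ := exists_abs_le_of_periodic hφ hper
  obtain ⟨δ, hδ, hφδ⟩ := Metric.uniformContinuous_iff.1 (uniformContinuous_of_periodic hφ hper)
    (ε / 2) (half_pos hε)
  have hM0 : 0 ≤ M := (abs_nonneg _).trans (hM 0)
  set N : ℕ := ⌊1 / δ⌋₊ + 1
  -- The at most N terms on long iterates, each bounded by 2M, then total at most n * ε / 2.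
  obtain ⟨n, hn⟩ := exists_nat_gt (N * (2 * M) / (ε / 2))
  have hn' := (div_lt_iff₀ (half_pos hε)).1 hn
  have hn0 : (0 : ℝ) < n := lt_of_le_of_lt (by positivity) hn
  refine ⟨n, by exact_mod_cast hn0, fun A hA hFA a ha b hgap s hs t ht => ?_⟩
  have hcard := card_large_gaps_le hmono hirr hA hFA hFs ha hgap hδ n
  have hterm : ∀ k ∈ Finset.range n, φ (F^[k] s) - φ (F^[k] t) ≤
      (if δ ≤ F^[k] b - F^[k] a then 2 * M else 0) + ε / 2 := by
    intro k _
    split_ifs with hk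
    · have h1 := abs_le.1 (hM (F^[k] s))
      have h2 := abs_le.1 (hM (F^[k] t))
      linarith
    · have hm := (hmono.iterate k).monotone
      have hdist : dist (F^[k] s) (F^[k] t) < δ := by
        rw [Real.dist_eq, abs_lt]
        constructor <;> linarith [hm hs.1, hm hs.2, hm ht.1, hm ht.2]
      have := hφδ hdist
      rw [Real.dist_eq] at this
      linarith [le_abs_self (φ (F^[k] s) - φ (F^[k] t))]
  have hsum := Finset.sum_le_sum hterm
  rw [Finset.sum_sub_distrib, Finset.sum_add_distrib, ← Finset.sum_filter, Finset.sum_const, Finset.sum_const,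
    Finset.card_range, nsmul_eq_mul, nsmul_eq_mul] at hsum
  have hcard' : (((Finset.range n).filter fun k => δ ≤ F^[k] b - F^[k] a).card : ℝ) ≤ (N : ℝ) := by
    exact_mod_cast hcard
  have := mul_le_mul_of_nonneg_right hcard' (by positivity : 0 ≤ 2 * M)
  rw [birkhoffSum, birkhoffSum]
  linarith

/-! ### The cohomological equation -/

/-- The average `u` of the first `n` Birkhoff sums of `φ` makes `φ` cohomologous to its `n`-th
Birkhoff average. -/
theorem exists_cohomologous_birkhoffAverage {F : CircleDeg1Lift} (hF : Continuous F) {φ : ℝ → ℝ}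
    (hφ : Continuous φ) (hper : Periodic φ 1) {n : ℕ} (hn : 0 < n) :
    ∃ u : ℝ → ℝ, Continuous u ∧ Periodic u 1 ∧
      ∀ t, φ t + u (F t) - u t = birkhoffSum F φ n t / n := by
  have hcont : ∀ k, Continuous (birkhoffSum F φ k) := fun k =>
    continuous_finsetSum _ fun i _ => hφ.comp (hF.iterate i)
  have hperS : ∀ k, Periodic (birkhoffSum F φ k) 1 := fun k t => by
    refine Finset.sum_congr rfl fun i _ => ?_
    have : F^[i] (t + 1) = F^[i] t + 1 := by
      rw [← CircleDeg1Lift.coe_pow, CircleDeg1Lift.map_add_one]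
    rw [this, hper]
  refine ⟨fun t => (∑ k ∈ Finset.range n, birkhoffSum F φ k t) / n,
    (continuous_finsetSum _ fun k _ => hcont k).div_const _,
    fun t => by simp only [hperS _ t], fun t => ?_⟩
  have hn0 : (n : ℝ) ≠ 0 := by exact_mod_cast hn.ne'
  -- Each S_k telescopes: S_k(F t) - S_k(t) = φ(F^k t) - φ(t).
  have key : ∑ k ∈ Finset.range n, birkhoffSum F φ k (F t) -
      ∑ k ∈ Finset.range n, birkhoffSum F φ k t = birkhoffSum F φ n t - n * φ t := by
    rw [← Finset.sum_sub_distrib,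
      Finset.sum_congr rfl fun k _ => birkhoffSum_apply_sub_birkhoffSum F φ k t,
      Finset.sum_sub_distrib, Finset.sum_const, Finset.card_range, nsmul_eq_mul, birkhoffSum]
  rw [add_sub_assoc, ← sub_div, key, sub_div, mul_div_cancel_left₀ _ hn0]
  ring

/-! ### Gaps and wandering intervals -/

/-- A point outside a closed periodic set lies in a gap of that set. -/
theorem exists_gap {A : Set ℝ} (hcl : IsClosed A) (hne : A.Nonempty)
    (hA : ∀ t ∈ A, ∀ m : ℤ, t + m ∈ A) {x : ℝ} (hx : x ∉ A) :
    ∃ a ∈ A, ∃ b ∈ A, x ∈ Ioo a b ∧ ∀ t ∈ Ioo a b, t ∉ A := by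
  obtain ⟨y, hy⟩ := hne
  have hlo : (A ∩ Iic x).Nonempty := by
    refine ⟨_, hA y hy ⌊x - y⌋, ?_⟩
    have := Int.floor_le (x - y)
    simp only [mem_Iic]; linarith
  have hhi : (A ∩ Ici x).Nonempty := by
    refine ⟨_, hA y hy ⌈x - y⌉, ?_⟩
    have := Int.le_ceil (x - y)
    simp only [mem_Ici]; linarith
  have hlb : BddAbove (A ∩ Iic x) := ⟨x, fun t ht => ht.2⟩
  have hhb : BddBelow (A ∩ Ici x) := ⟨x, fun t ht => ht.2⟩
  have ha := (hcl.inter isClosed_Iic).csSup_mem hlo hlb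
  have hb := (hcl.inter isClosed_Ici).csInf_mem hhi hhb
  refine ⟨_, ha.1, _, hb.1, ⟨lt_of_le_of_ne ha.2 fun h => hx (h ▸ ha.1),
    lt_of_le_of_ne hb.2 fun h => hx (h ▸ hb.1)⟩, fun t ht htA => ?_⟩
  rcases le_total t x with h | h
  · exact (le_csSup hlb ⟨htA, h⟩).not_gt ht.1
  · exact (csInf_le hhb ⟨htA, h⟩).not_gt ht.2

/-- The image of (a, b) and the complement of the image of [a, b] are disjoint open sets covering
Kᶜ, so the component stays in the first. Inclusion suffices, since distortion bounds pass to
subsets. -/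
theorem closure_connectedComponentIn_subset {Y : Type*} [TopologicalSpace Y] [T2Space Y]
    {p : ℝ → Y} (hp : Continuous p) (hpo : IsOpenMap p) {K : Set Y} {a b x : ℝ} (ha : p a ∈ K)
    (hb : p b ∈ K) (hx : x ∈ Ioo a b) (hxK : p x ∈ Kᶜ) :
    closure (connectedComponentIn Kᶜ (p x)) ⊆ p '' Icc a b := by
  have hcl : IsClosed (p '' Icc a b) := (isCompact_Icc.image hp).isClosed
  refine closure_minimal (Subset.trans ?_ (image_mono Ioo_subset_Icc_self)) hcl
  refine isPreconnected_connectedComponentIn.subset_left_of_subset_union (hpo _ isOpen_Ioo)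
    hcl.isOpen_compl (disjoint_compl_right.mono_left (image_mono Ioo_subset_Icc_self)) ?_
    ⟨p x, mem_connectedComponentIn hxK, mem_image_of_mem p hx⟩
  intro y hy
  have hyK := connectedComponentIn_subset _ _ hy
  by_cases hyI : y ∈ p '' Icc a b
  · obtain ⟨t, ht, rfl⟩ := hyI
    refine Or.inl ⟨t, ⟨lt_of_le_of_ne ht.1 ?_, lt_of_le_of_ne ht.2 ?_⟩, rfl⟩
    · rintro rfl; exact hyK ha
    · rintro rfl; exact hyK hb
  · exact Or.inr hyI

/-! ### Distortion and conjugation in lifts -/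

theorem IsLift.hasCircleDerivAt_iff {g : S1 → S1} {G : CircleDeg1Lift} (hG : IsLift G g)
    (hd : Differentiable ℝ G) {d t : ℝ} : HasCircleDerivAt g d (t : S1) ↔ d = deriv G t := by
  constructor
  · rintro ⟨F, hF, s, hst, hs⟩
    obtain ⟨m, hm⟩ := hG.exists_int hF
    obtain ⟨k, rfl⟩ := coe_eq_coe_iff.1 hst
    have hFG : (F : ℝ → ℝ) = fun t => G t + m := funext hm
    rw [← hs.deriv, hFG, deriv_add_const]
    simpa using ((periodic_deriv G).int_mul k) t
  · rintro rfl
    exact ⟨G, hG, t, rfl, (hd t).hasDerivAt⟩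

/-- The log-derivative descends to a continuous function on the circle, so compactness of I × I
makes the maximum attained. -/
theorem exists_isDistortion_le {g : S1 → S1} {G : CircleDeg1Lift} (hG : IsLift G g)
    (hG1 : ContDiff ℝ 1 G) (hG2 : ∀ t, 0 < deriv G t) {I : Set S1} (hI : IsClosed I)
    (hne : I.Nonempty) {ε : ℝ} (hε : ∀ s t : ℝ, (s : S1) ∈ I → (t : S1) ∈ I →
      Real.log (deriv G s) - Real.log (deriv G t) ≤ ε) :
    ∃ δ, IsDistortion g I δ ∧ δ ≤ ε := by
  have hper : Periodic (fun t => Real.log (deriv G t)) 1 := fun t => by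
    simp only [periodic_deriv G t]
  have hlog : Continuous fun t => Real.log (deriv G t) :=
    hG1.continuous_deriv_one.log fun t => (hG2 t).ne'
  have hc : Continuous (hper.lift : S1 → ℝ) := continuous_coinduced_dom.2 hlog
  have hset : {r : ℝ | ∃ x ∈ I, ∃ y ∈ I, ∃ a b : ℝ, HasCircleDerivAt g a x ∧
      HasCircleDerivAt g b y ∧ r = Real.log (a / b)} =
      (fun p : S1 × S1 => hper.lift p.1 - hper.lift p.2) '' I ×ˢ I := by
    have hd := hG1.differentiable one_ne_zero
    ext r
    constructor
    · rintro ⟨x, hx, y, hy, a, b, ha, hb, rfl⟩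
      obtain ⟨s, rfl⟩ := QuotientAddGroup.mk_surjective x
      obtain ⟨t, rfl⟩ := QuotientAddGroup.mk_surjective y
      obtain rfl := (hG.hasCircleDerivAt_iff hd).1 ha
      obtain rfl := (hG.hasCircleDerivAt_iff hd).1 hb
      exact ⟨(_, _), ⟨hx, hy⟩, (Real.log_div (hG2 s).ne' (hG2 t).ne').symm⟩
    · rintro ⟨⟨x, y⟩, ⟨hx, hy⟩, rfl⟩
      obtain ⟨s, rfl⟩ := QuotientAddGroup.mk_surjective x
      obtain ⟨t, rfl⟩ := QuotientAddGroup.mk_surjective y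
      exact ⟨_, hx, _, hy, _, _, (hG.hasCircleDerivAt_iff hd).2 rfl,
        (hG.hasCircleDerivAt_iff hd).2 rfl, (Real.log_div (hG2 s).ne' (hG2 t).ne').symm⟩
  obtain ⟨δ, hδ⟩ := ((hI.isCompact.prod hI.isCompact).image
    ((hc.comp continuous_fst).sub (hc.comp continuous_snd))).exists_isGreatest
    ((hne.prod hne).image _)
  refine ⟨δ, by rw [IsDistortion, hset]; exact hδ, ?_⟩
  obtain ⟨⟨x, y⟩, ⟨hx, hy⟩, rfl⟩ := hδ.1
  obtain ⟨s, rfl⟩ := QuotientAddGroup.mk_surjective x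
  obtain ⟨t, rfl⟩ := QuotientAddGroup.mk_surjective y
  exact hε s t hx hy

/-- The logarithmic derivative of a conjugate `h f h⁻¹`, in lifts. -/
theorem log_deriv_conj {f h g : S1 → S1} {F H G : CircleDeg1Lift} (hF : IsLift F f)
    (hH : IsLift H h) (hG : IsLift G g) (hsemi : Semiconj h f g) (hF1 : Differentiable ℝ F)
    (hH1 : Differentiable ℝ H) (hG1 : Differentiable ℝ G) (hF2 : ∀ t, 0 < deriv F t)
    (hH2 : ∀ t, 0 < deriv H t) (hG2 : ∀ t, 0 < deriv G t) (t : ℝ) :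
    Real.log (deriv G (H t)) =
      Real.log (deriv F t) + Real.log (deriv H (F t)) - Real.log (deriv H t) := by
  have h1 : IsLift (G * H) (g ∘ h) := ⟨hG.1.comp hH.1, fun t => by
    rw [CircleDeg1Lift.mul_apply, hG.2, hH.2, comp_apply]⟩
  have h2 : IsLift (H * F) (g ∘ h) := ⟨hH.1.comp hF.1, fun t => by
    rw [CircleDeg1Lift.mul_apply, hH.2, hF.2, hsemi, comp_apply]⟩
  obtain ⟨m, hm⟩ := h2.exists_int h1
  have heq : (G : ℝ → ℝ) ∘ H = fun t => (H ∘ F) t + m := funext hm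
  have hd : deriv G (H t) * deriv H t = deriv H (F t) * deriv F t := by
    rw [← deriv_comp t (hG1 _) (hH1 _), ← deriv_comp t (hH1 _) (hF1 _), heq, deriv_add_const]
  have := congrArg Real.log hd
  rw [Real.log_mul (hG2 _).ne' (hH2 _).ne', Real.log_mul (hH2 _).ne' (hF2 _).ne'] at this
  linarith

end CircleDynamics

/-! ### The conjugacy -/

open CircleDynamics Set Function in
theorem mainTheorem4 (f : CircleDynamics.Diff1) (α : ℝ) (hα : Irrational α)
    (hf : CircleDynamics.HasRotationNumber f.1 (α : CircleDynamics.S1))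
    (ε : ℝ) (hε : 0 < ε) :
    ∃ h : CircleDynamics.Diff1, ∀ I : Set CircleDynamics.S1,
      CircleDynamics.IsWanderingInterval (h * f * h⁻¹).1 I →
        ∃ δ : ℝ, CircleDynamics.IsDistortion (h * f * h⁻¹).1 I δ ∧ δ ≤ ε := by
  obtain ⟨F, hFl, hF1, hF2⟩ := f.2
  have hFs : Surjective F := F.continuous_iff_surjective.1 hFl.1
  have hFm : StrictMono F := strictMono_of_deriv_pos hF2
  have hφ : Continuous fun t => Real.log (deriv F t) :=
    hF1.continuous_deriv_one.log fun t => (hF2 t).ne'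
  have hper : Periodic (fun t => Real.log (deriv F t)) 1 := fun t => by
    simp only [periodic_deriv F t]
  obtain ⟨n, hn, hsmall⟩ := exists_birkhoffSum_sub_le hFm hFs
    (fun n hn m t => hf.iterate_ne hα hFl hn m t) hφ hper hε
  obtain ⟨u, hu, huper, hcob⟩ := exists_cohomologous_birkhoffAverage hFl.1 hφ hper hn
  obtain ⟨H, c, hH1, hH2, hHu⟩ := exists_log_deriv_eq hu huper
  obtain ⟨h, hHl⟩ := exists_diff1_isLift hH1 hH2
  refine ⟨h, ?_⟩
  obtain ⟨G, hGl, hG1, hG2⟩ := (h * f * h⁻¹).2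
  have hsemi : Semiconj h.1 f.1 (h * f * h⁻¹).1 := fun x =>
    congrArg (fun y => h.1 (f.1 y)) (h.1.symm_apply_apply x).symm
  generalize (h * f * h⁻¹).1 = g at hGl hsemi
  have hlogG : ∀ t, Real.log (deriv G (H t)) =
      birkhoffSum F (fun t => Real.log (deriv F t)) n t / n := fun t => by
    rw [log_deriv_conj hFl hHl hGl hsemi (hF1.differentiable one_ne_zero)
      (hH1.differentiable one_ne_zero) (hG1.differentiable one_ne_zero) hF2 hH2 hG2, ← hcob, hHu,
      hHu]
    ring
  rintro I ⟨K, hK, x, hxK, rfl⟩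
  obtain ⟨⟨hKne, hKcl, hKg⟩, -⟩ := hK
  -- Pulling K back by h composed with the projection makes it F-invariant, so the gap estimate for
  -- F applies.
  let p : ℝ → S1 := fun t => h.1 (t : S1)
  have hpc : Continuous p := h.1.continuous.comp (AddCircle.continuous_mk' 1)
  have hpo : IsOpenMap p := h.1.isOpenMap.comp QuotientAddGroup.isOpenMap_coe
  have hps : Surjective p := h.1.surjective.comp QuotientAddGroup.mk_surjective
  obtain ⟨t₀, rfl⟩ := hps x
  have hA : ∀ t ∈ p ⁻¹' K, ∀ m : ℤ, t + m ∈ p ⁻¹' K := by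
    intro t ht m
    have : ((t + m : ℝ) : S1) = t := coe_eq_coe_iff.2 ⟨m, rfl⟩
    change h.1 ((t + m : ℝ) : S1) ∈ K
    rw [this]
    exact ht
  have hFA : ∀ t, F t ∈ p ⁻¹' K ↔ t ∈ p ⁻¹' K := by
    intro t
    change h.1 ((F t : ℝ) : S1) ∈ K ↔ p t ∈ K
    rw [hFl.2, hsemi]
    conv_lhs => rw [← hKg]
    exact g.injective.mem_set_image
  obtain ⟨a, ha, b, hb, ht₀, hgap⟩ := exists_gap (hKcl.preimage hpc) (hKne.preimage hps) hA hxK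
  have hsub := closure_connectedComponentIn_subset hpc hpo ha hb ht₀ hxK
  refine exists_isDistortion_le hGl hG1 hG2 isClosed_closure
    ⟨_, subset_closure (mem_connectedComponentIn hxK)⟩ fun s t hs ht => ?_
  have hred : ∀ s : ℝ, (s : S1) ∈ p '' Icc a b → ∃ s' ∈ Icc a b, Real.log (deriv G s) =
      birkhoffSum F (fun t => Real.log (deriv F t)) n s' / n := by
    rintro s ⟨s', hs', hss'⟩
    refine ⟨s', hs', ?_⟩
    -- The given lift s and H s' project to the same point, and `deriv G` is 1-periodic.
    obtain ⟨m, rfl⟩ := coe_eq_coe_iff.1 (hss'.symm.trans (hHl.2 s').symm)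
    rw [← hlogG]
    congr 1
    simpa using ((periodic_deriv G).int_mul m) (H s')
  obtain ⟨s', hs', hs''⟩ := hred s (hsub hs)
  obtain ⟨t', ht', ht''⟩ := hred t (hsub ht)
  rw [hs'', ht'', ← sub_div, div_le_iff₀ (by exact_mod_cast hn), mul_comm]
  exact hsmall _ hA hFA a ha b hgap s' hs' t' ht'
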